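/- Let $k\ge 1$, let $Q_0,\dots,Q_k\in\mathbb{C}[w]$ with $Q_k\not\equiv 0$, and let $T=\sum_{j=0}^k Q_j(w)\frac{d^j}{dw^j}$ be non-degenerate, i.e. $\max_{0\le j\le k}(\deg Q_j-j)=\deg Q_k-k$ (with $\deg 0=-\infty$). A set $S\subset\mathbb{C}$ is called Hutchinson invariant in degree $n$ if it is closed and non-empty and, for every $z\in S$, all zeros of the polynomial $T[(w-z)^n]$ (in the variable $w$) lie in $S$. The minimal Hutchinson invariant set in degree $n$, if it exists, is the Hutchinson invariant set in degree $n$ that is contained in every other one; it is denoted $M_{H,n}$. Suppose that $Q_k$ has at least one simple zero. Then for every $\epsilon>0$ there is $N$ such that for all $n\ge N$: 1. $M_{H,n}$ exists, is contained in the $\epsilon$-neighbourhood of the set of zeros of $Q_k$, and contains all simple zeros of $Q_k$. 2. If $k\ge 2$, at least one $Q_j$ with $j\ne k$ is not identically zero, $\deg Q_k\ge 2$, and $Q_0,\dots,Q_k$ have no common zero in $\mathbb{C}$, then $M_{H,n}$ is a perfect set (it is closed and has no isolated point). -/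

import Mathlib

namespace Hutchinson

open Polynomial

/-- The linear differential operator `T = ∑_{j=0}^k Q_j(w) d^j/dw^j` on `ℂ[w]`.
Only `Q 0, …, Q k` matter. -/
noncomputable def diffOp (k : ℕ) (Q : ℕ → ℂ[X]) : ℂ[X] →ₗ[ℂ] ℂ[X] :=
  ∑ j ∈ Finset.range (k + 1), (LinearMap.mulLeft ℂ (Q j)) ∘ₗ (Polynomial.derivative ^ j)

/-- The operator has order `k` (that is, `Q_k ≠ 0`), and
`max_{0 ≤ j ≤ k} (deg Q_j - j) = deg Q_k - k`, where `deg 0 = -∞`. -/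
def NonDegenerate (k : ℕ) (Q : ℕ → ℂ[X]) : Prop :=
  Q k ≠ 0 ∧ ∀ j ≤ k, Q j ≠ 0 →
    ((Q j).natDegree : ℤ) - (j : ℤ) ≤ ((Q k).natDegree : ℤ) - (k : ℤ)

/-- `S ⊆ ℂ` is Hutchinson invariant in degree `n` for `T`: it is closed and non-empty, and for
every `z ∈ S` all zeros of `T[(w - z)^n]` lie in `S`. -/
def IsInvariant (T : ℂ[X] →ₗ[ℂ] ℂ[X]) (n : ℕ) (S : Set ℂ) : Prop :=
  IsClosed S ∧ S.Nonempty ∧ ∀ z ∈ S, ∀ w : ℂ, (T ((X - C z) ^ n)).IsRoot w → w ∈ S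

/-- `S` is the minimal Hutchinson invariant set of degree `n`: it is Hutchinson invariant in
degree `n` and contained in every other such set. -/
def IsMinimalInvariant (T : ℂ[X] →ₗ[ℂ] ℂ[X]) (n : ℕ) (S : Set ℂ) : Prop :=
  IsLeast {S' : Set ℂ | IsInvariant T n S'} S

end Hutchinson

/-!
Factor `T[(w - z)^n] = (n)_k (w - z)^(n - k) P_{n,z}(w)` for `n ≥ k`. In the cofactor `P_{n,z}` the
term of `T` of order `j` has weight `(n)_j / (n)_k`, which tends to `0` for `j < k`, so
`P_{n,z} → Q_k` as `n → ∞`; non-degeneracy makes this uniform in `w` up to infinity, where no term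
outgrows `Q_k`. Hence for large `n` a closed neighbourhood of the zeros of `Q_k` is invariant.

A simple zero `u` of `Q_k` attracts: for large `n` and every `z ≠ u`, some zero of `P_{n,z}` is
closer to `u` than `z` is. Near `u` this holds because `P_{n,z}(u) = o(|u - z|)` while the
derivative of `P_{n,z}` at `u` stays away from `0`, and far from `u` because of the bound at
infinity. A closed invariant set therefore contains `u`, and the intersection of all invariant sets
is the minimal one.

Suppose moreover that the `Q_j` have no common zero and `deg Q_k ≥ 2`. Then for large `n` no `z ≠ u`
in the minimal set `M` has `u` as a zero of `P_{n,z}`, so if `u` were isolated in `M`, then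
`M \ {u}` would be invariant. Hence `M` has an accumulation point; as the zeros of `P_{n,z}` depend
continuously on `z`, the derived set of `M` is invariant too, and by minimality equals `M`.
-/

namespace Hutchinson

open Polynomial Filter Topology Asymptotics Metric

section Roots

variable {K : Type*} [NormedField K] {p : K[X]}

lemma norm_eval_eq_prod_roots (hp : p.Splits) (x : K) :
    ‖p.eval x‖ = ‖p.leadingCoeff‖ * (p.roots.map fun r => ‖x - r‖).prod := by
  rw [hp.eval_eq_prod_roots, norm_mul]
  congr 1
  simpa [Multiset.map_map, Function.comp_def] using
    map_multiset_prod (normHom : K →*₀ ℝ) (p.roots.map (x - ·))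

lemma exists_isRoot_forall_norm_sub_le (hp : p.Splits) (hd : 0 < p.natDegree) (x : K) :
    ∃ r, p.IsRoot r ∧ ∀ s ∈ p.roots, ‖x - r‖ ≤ ‖x - s‖ := by
  classical
  have hne : p.roots.toFinset.Nonempty := by
    rwa [Multiset.toFinset_nonempty, ← Multiset.card_pos, ← hp.natDegree_eq_card_roots]
  obtain ⟨r, hr, hmin⟩ := p.roots.toFinset.exists_min_image (fun r => ‖x - r‖) hne
  exact ⟨r, isRoot_of_mem_roots (Multiset.mem_toFinset.1 hr),
    fun s hs => hmin s (Multiset.mem_toFinset.2 hs)⟩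

lemma exists_isRoot_norm_sub_pow_le (hp : p.Splits) (hd : 0 < p.natDegree) (x : K) :
    ∃ r, p.IsRoot r ∧ ‖p.leadingCoeff‖ * ‖x - r‖ ^ p.natDegree ≤ ‖p.eval x‖ := by
  obtain ⟨r, hr, hmin⟩ := exists_isRoot_forall_norm_sub_le hp hd x
  refine ⟨r, hr, ?_⟩
  rw [norm_eval_eq_prod_roots hp, hp.natDegree_eq_card_roots, ← Multiset.prod_replicate,
    ← Multiset.map_const']
  gcongr
  exact Multiset.prod_map_le_prod_map₀ _ _ (fun _ _ => norm_nonneg _) hmin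

-- The nearest root `r` works because `p' / p` is the sum of `1 / (x - s)` over the roots `s`.
lemma exists_isRoot_norm_derivative_mul_le (hp : p.Splits) (hd : 0 < p.natDegree) (x : K) :
    ∃ r, p.IsRoot r ∧ ‖p.derivative.eval x‖ * ‖x - r‖ ≤ p.natDegree * ‖p.eval x‖ := by
  by_cases hx : p.eval x = 0
  · exact ⟨x, hx, by simp [hx]⟩
  obtain ⟨r, hr, hmin⟩ := exists_isRoot_forall_norm_sub_le hp hd x
  have hxr : 0 < ‖x - r‖ := by
    rw [norm_pos_iff, sub_ne_zero]
    rintro rfl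
    exact hx hr
  have hterm : ∀ y ∈ p.roots.map fun s => ‖1 / (x - s)‖, y ≤ ‖x - r‖⁻¹ := by
    simp only [Multiset.mem_map, forall_exists_index, and_imp, forall_apply_eq_imp_iff₂,
      one_div, norm_inv]
    exact fun s hs => inv_anti₀ hxr (hmin s hs)
  have hsum : ‖(p.roots.map fun s => 1 / (x - s)).sum‖ ≤ p.natDegree * ‖x - r‖⁻¹ := by
    refine (norm_multiset_sum_le _).trans ?_
    rw [Multiset.map_map]
    refine (Multiset.sum_le_card_nsmul _ _ hterm).trans_eq ?_
    rw [Multiset.card_map, ← hp.natDegree_eq_card_roots, nsmul_eq_mul]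
  refine ⟨r, hr, ?_⟩
  calc ‖p.derivative.eval x‖ * ‖x - r‖
      ≤ ‖p.eval x‖ * (p.natDegree * ‖x - r‖⁻¹) * ‖x - r‖ := by
        rw [hp.eval_derivative_eq_eval_mul_sum hx, norm_mul]
        gcongr
    _ = p.natDegree * ‖p.eval x‖ := by field_simp

lemma eventually_exists_isRoot_norm_sub_lt {Z : Type*} [TopologicalSpace Z] {P : Z → K[X]}
    {z : Z} {x : K} {d : ℕ} (hP : ∀ᶠ z' in 𝓝 z, (P z').Splits) (hd : 0 < d)
    (hdeg : ∀ᶠ z' in 𝓝 z, (P z').natDegree = d)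
    (hcoeff : ContinuousAt (fun z' => (P z').coeff d) z)
    (heval : ContinuousAt (fun z' => (P z').eval x) z) (hx : (P z).IsRoot x)
    {δ : ℝ} (hδ : 0 < δ) :
    ∀ᶠ z' in 𝓝 z, ∃ r, (P z').IsRoot r ∧ ‖x - r‖ < δ := by
  have hlead : (P z).coeff d ≠ 0 := by
    rw [← hdeg.self_of_nhds, coeff_natDegree, leadingCoeff_ne_zero]
    rintro h0
    have := hdeg.self_of_nhds
    simp [h0, hd.ne] at this
  have hpos : ‖(P z).eval x‖ < ‖(P z).coeff d‖ * δ ^ d := by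
    rw [IsRoot.def.1 hx, norm_zero]
    positivity
  filter_upwards [hP, hdeg, heval.norm.eventually_lt (hcoeff.norm.mul_const _) hpos]
    with z' hsplit hdeg' hlt
  obtain ⟨r, hr, hle⟩ := exists_isRoot_norm_sub_pow_le hsplit (hdeg' ▸ hd) x
  rw [leadingCoeff, hdeg'] at hle
  exact ⟨r, hr, lt_of_pow_lt_pow_left₀ d hδ.le <|
    lt_of_mul_lt_mul_left (hle.trans_lt hlt) (norm_nonneg _)⟩

lemma isBigO_eval_one_add_norm_pow {d : ℕ} (hd : p.natDegree ≤ d) :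
    (fun x => p.eval x) =O[⊤] fun x : K => (1 + ‖x‖) ^ d := by
  simp only [eval_eq_sum_range' (Nat.lt_succ_of_le hd)]
  refine IsBigO.fun_sum fun i hi => IsBigO.const_mul_left (isBigO_of_le _ fun x => ?_) _
  have hx := norm_nonneg x
  rw [norm_pow, norm_pow, Real.norm_of_nonneg (by positivity)]
  calc ‖x‖ ^ i ≤ (1 + ‖x‖) ^ i := by gcongr; linarith
    _ ≤ (1 + ‖x‖) ^ d := pow_le_pow_right₀ (by linarith) (Finset.mem_range_succ_iff.1 hi)

lemma isBigO_eval_mul_X_sub_C_pow {d m : ℕ} (hd : p.natDegree + m ≤ d) {B : Set K}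
    (hB : Bornology.IsBounded B) :
    (fun y : K × K => (p * (X - C y.1) ^ m).eval y.2) =O[𝓟 (B ×ˢ Set.univ)]
      fun y => (1 + ‖y.2‖) ^ d := by
  obtain ⟨R, hR⟩ := hB.exists_norm_le
  have hsub : (fun y : K × K => y.2 - y.1) =O[𝓟 (B ×ˢ Set.univ)] fun y => 1 + ‖y.2‖ := by
    refine isBigO_principal.2 ⟨1 + |R|, fun y hy => ?_⟩
    have h₁ := norm_sub_le y.2 y.1
    have h₂ := (hR y.1 hy.1).trans (le_abs_self R)
    have h₃ := mul_nonneg (abs_nonneg R) (norm_nonneg y.2)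
    rw [Real.norm_of_nonneg (by positivity)]
    linarith
  have heval : (fun y : K × K => p.eval y.2) =O[𝓟 (B ×ˢ Set.univ)]
      fun y => (1 + ‖y.2‖) ^ (d - m) :=
    (isBigO_eval_one_add_norm_pow (Nat.le_sub_of_add_le hd)).comp_tendsto tendsto_top
  simpa only [eval_mul, eval_pow, eval_sub, eval_X, eval_C, ← pow_add,
    Nat.sub_add_cancel ((Nat.le_add_left _ _).trans hd)] using heval.mul (hsub.pow m)

lemma isBigO_one_add_norm_sub {E : Type*} [SeminormedAddCommGroup E] {r : E} {δ : ℝ} (hδ : 0 < δ)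
    {s : Set E} (hs : ∀ x ∈ s, δ ≤ ‖x - r‖) : (fun x => 1 + ‖x‖) =O[𝓟 s] fun x => x - r := by
  refine isBigO_principal.2 ⟨(1 + ‖r‖) / δ + 1, fun x hx => ?_⟩
  have h₁ : ‖x‖ ≤ ‖x - r‖ + ‖r‖ := by simpa using norm_add_le (x - r) r
  have h₂ : 1 + ‖r‖ ≤ (1 + ‖r‖) / δ * ‖x - r‖ := by
    rw [div_mul_eq_mul_div, le_div_iff₀ hδ]
    gcongr
    exact hs x hx
  rw [Real.norm_of_nonneg (by positivity)]
  linarith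

lemma isBigO_one_add_norm_pow_eval (hp : p.Splits) (hp0 : p ≠ 0) {δ : ℝ} (hδ : 0 < δ) :
    (fun x => (1 + ‖x‖) ^ p.natDegree) =O[𝓟 (thickening δ {r | p.IsRoot r})ᶜ]
      fun x => p.eval x := by
  have hprod := IsBigO.multisetProd (s := p.roots) (f := fun _ x => 1 + ‖x‖)
    (g := fun r x => x - r) (l := 𝓟 (thickening δ {r | p.IsRoot r})ᶜ) fun r hr =>
      isBigO_one_add_norm_sub hδ fun x hx => by
        rw [← dist_eq_norm]
        exact not_lt.1 fun h => hx (mem_thickening_iff.2 ⟨r, isRoot_of_mem_roots hr, h⟩)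
  simp only [Multiset.map_const', Multiset.prod_replicate,
    ← hp.natDegree_eq_card_roots] at hprod
  simpa only [hp.eval_eq_prod_roots] using
    (isBigO_const_mul_right_iff (leadingCoeff_ne_zero.2 hp0)).2 hprod

end Roots

lemma exists_isRoot_ne {R : Type*} [CommRing R] [IsDomain R] {p : R[X]} (hp : p.Splits) {u : R}
    (hu : p.rootMultiplicity u < p.natDegree) :
    ∃ r, p.IsRoot r ∧ r ≠ u := by
  classical
  by_contra! h
  have hcount : p.roots.count u = Multiset.card p.roots :=
    Multiset.count_eq_card.2 fun r hr => (h r (isRoot_of_mem_roots hr)).symm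
  rw [count_roots, ← hp.natDegree_eq_card_roots] at hcount
  exact hu.ne hcount

lemma rootMultiplicity_eq_one_iff {R : Type*} [CommRing R] {p : R[X]} (hp : p ≠ 0) {u : R} :
    p.rootMultiplicity u = 1 ↔ p.IsRoot u ∧ p.derivative.eval u ≠ 0 := by
  have h₁ := one_lt_rootMultiplicity_iff_isRoot (t := u) hp
  have h₂ := rootMultiplicity_pos (x := u) hp
  rw [IsRoot.def (p := p.derivative)] at h₁
  grind

lemma eventually_norm_lt_norm_of_isLittleO {α E F : Type*} [SeminormedAddCommGroup E]
    [NormedAddCommGroup F] {l : Filter α} {f : α → E} {g : α → F} (h : f =o[l] g) :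
    ∀ᶠ x in l, g x ≠ 0 → ‖f x‖ < ‖g x‖ := by
  filter_upwards [h.bound one_half_pos] with x hx hg
  linarith [norm_pos_iff.2 hg]

lemma mem_of_forall_exists_dist_lt {X : Type*} [PseudoMetricSpace X] [ProperSpace X] {S : Set X}
    (hS : IsClosed S) (hne : S.Nonempty) {u : X}
    (h : ∀ z ∈ S, z ≠ u → ∃ w ∈ S, dist u w < dist u z) : u ∈ S := by
  obtain ⟨z, hz, hdist⟩ := hS.exists_infDist_eq_dist hne u
  by_contra hu
  obtain ⟨w, hw, hlt⟩ := h z hz (by rintro rfl; exact hu hz)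
  exact (hdist ▸ infDist_le_dist_of_mem hw).not_gt hlt


section Cofactor

/-- The ratio `(n)_j / (n)_k` of falling factorials: the relative weight with which the term of
order `j` of `T` enters `T[(w - z)^n]`. It is only used for `n ≥ k`, where `(n)_k ≠ 0`. -/
noncomputable def weight (k n j : ℕ) : ℂ := n.descFactorial j / n.descFactorial k

lemma cast_descFactorial_ne_zero {k n : ℕ} (hk : k ≤ n) : (n.descFactorial k : ℂ) ≠ 0 :=
  Nat.cast_ne_zero.2 (Nat.descFactorial_pos.2 hk).ne'

lemma weight_ne_zero {k n j : ℕ} (hk : k ≤ n) (hj : j ≤ n) : weight k n j ≠ 0 :=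
  div_ne_zero (cast_descFactorial_ne_zero hj) (cast_descFactorial_ne_zero hk)

lemma weight_self {k n : ℕ} (hk : k ≤ n) : weight k n k = 1 :=
  div_self (cast_descFactorial_ne_zero hk)

lemma weight_mul_weight {m k n : ℕ} (hm : m ≤ n) (j : ℕ) :
    weight k n m * weight m n j = weight k n j := by
  rw [weight, weight, mul_comm, div_mul_div_cancel₀ (cast_descFactorial_ne_zero hm), weight]

lemma tendsto_weight {k j : ℕ} (hj : j < k) : Tendsto (weight k · j) atTop (𝓝 0) := by
  have hpow : Tendsto (fun n : ℕ => (n : ℝ) ^ j / (n : ℝ) ^ k) atTop (𝓝 0) :=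
    (tendsto_pow_div_pow_atTop_zero hj).comp tendsto_natCast_atTop_atTop
  have hreal := ((isEquivalent_descFactorial j).div (isEquivalent_descFactorial k)).symm
    |>.tendsto_nhds hpow
  have hcast := (Complex.continuous_ofReal.tendsto 0).comp hreal
  simpa only [weight, Function.comp_def, Pi.div_apply, Complex.ofReal_div, Complex.ofReal_natCast,
    Complex.ofReal_zero] using hcast

/-- The cofactor of `(w - z)^(n - k)` in `T[(w - z)^n]`, divided by the falling factorial `(n)_k`
so that it tends to `Q_k` as `n → ∞`. -/
noncomputable def cofactor (k : ℕ) (Q : ℕ → ℂ[X]) (n : ℕ) (z : ℂ) : ℂ[X] :=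
  ∑ j ∈ Finset.range (k + 1), weight k n j • (Q j * (X - C z) ^ (k - j))

variable {k : ℕ} {Q : ℕ → ℂ[X]} {n : ℕ}

lemma diffOp_X_sub_C_pow (hk : k ≤ n) (z : ℂ) :
    diffOp k Q ((X - C z) ^ n) =
      (n.descFactorial k : ℂ) • ((X - C z) ^ (n - k) * cofactor k Q n z) := by
  simp only [diffOp, cofactor, LinearMap.sum_apply, Finset.mul_sum, Finset.smul_sum]
  refine Finset.sum_congr rfl fun j hj => ?_
  have hjk : n - j = (n - k) + (k - j) := by
    have := Finset.mem_range_succ_iff.1 hj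
    omega
  rw [LinearMap.comp_apply, Module.End.pow_apply, iterate_derivative_X_sub_pow,
    LinearMap.mulLeft_apply, mul_smul_comm, mul_smul_comm, smul_smul, weight,
    mul_div_cancel₀ _ (cast_descFactorial_ne_zero hk), ← Nat.cast_smul_eq_nsmul ℂ, hjk, pow_add,
    mul_left_comm]

lemma isRoot_diffOp_iff (hk : k < n) (z w : ℂ) :
    (diffOp k Q ((X - C z) ^ n)).IsRoot w ↔ w = z ∨ (cofactor k Q n z).IsRoot w := by
  rw [diffOp_X_sub_C_pow hk.le]
  simp [IsRoot.def, Nat.descFactorial_eq_zero_iff_lt, hk.le, sub_eq_zero, Nat.sub_ne_zero_of_lt hk]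

lemma isInvariant_diffOp_iff (hk : k < n) {S : Set ℂ} :
    IsInvariant (diffOp k Q) n S ↔ IsClosed S ∧ S.Nonempty ∧
      ∀ z ∈ S, ∀ w, (cofactor k Q n z).IsRoot w → w ∈ S := by
  simp only [IsInvariant, isRoot_diffOp_iff hk]
  grind

lemma eval_cofactor (z w : ℂ) : (cofactor k Q n z).eval w =
    ∑ j ∈ Finset.range (k + 1), weight k n j * ((Q j).eval w * (w - z) ^ (k - j)) := by
  simp [cofactor, eval_finsetSum]

lemma eval_cofactor_self (hk : k ≤ n) (z : ℂ) : (cofactor k Q n z).eval z = (Q k).eval z := by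
  rw [eval_cofactor, Finset.sum_range_succ, Finset.sum_eq_zero fun j hj => ?_]
  · simp [weight_self hk]
  · simp [Nat.sub_ne_zero_of_lt (Finset.mem_range.1 hj)]

-- Uniformity in `z` comes from the filter: along `l = 𝓟 s` the estimate is uniform over `s`.
lemma isLittleO_apply_cofactor_sub {ι E F : Type*} [NormedAddCommGroup E] [NormedSpace ℂ E]
    [SeminormedAddCommGroup F] {l : Filter ι} {φ : ι → ℂ[X] →ₗ[ℂ] E} {z : ι → ℂ} {f : ι → F}
    (h : ∀ j < k, (fun i => φ i (Q j * (X - C (z i)) ^ (k - j))) =O[l] f) :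
    (fun p : ℕ × ι => φ p.2 (cofactor k Q p.1 (z p.2)) - φ p.2 (Q k))
      =o[atTop ×ˢ l] fun p => f p.2 := by
  have hsum : (fun p : ℕ × ι => ∑ j ∈ Finset.range k,
      weight k p.1 j • φ p.2 (Q j * (X - C (z p.2)) ^ (k - j))) =o[atTop ×ˢ l]
        fun p => f p.2 := by
    refine IsLittleO.fun_sum fun j hj => ?_
    have hw : (fun p : ℕ × ι => weight k p.1 j) =o[atTop ×ˢ l] fun _ => (1 : ℝ) :=
      (isLittleO_one_iff ℝ).2 ((tendsto_weight (Finset.mem_range.1 hj)).comp tendsto_fst)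
    have hφ := ((h j (Finset.mem_range.1 hj)).comp_tendsto
      (tendsto_snd (f := (atTop : Filter ℕ)))).norm_right
    simpa only [Function.comp_def, one_smul, isLittleO_norm_right] using hw.smul_isBigO hφ
  refine hsum.congr' ?_ EventuallyEq.rfl
  filter_upwards [tendsto_fst.eventually (eventually_ge_atTop k)] with p hp
  simp [cofactor, Finset.sum_range_succ, weight_self hp]

lemma continuous_apply_mul_X_sub_C_pow (φ : ℂ[X] →ₗ[ℂ] ℂ) (p : ℂ[X]) (m : ℕ) :
    Continuous fun z => φ (p * (X - C z) ^ m) := by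
  induction m generalizing p with
  | zero => simpa using continuous_const
  | succ m ih =>
    have hstep (z : ℂ) :
        p * (X - C z) ^ (m + 1) = p * X * (X - C z) ^ m - z • (p * (X - C z) ^ m) := by
      rw [smul_eq_C_mul]
      ring
    simp only [hstep, map_sub, map_smul]
    exact (ih _).sub (continuous_id.smul (ih p))

lemma continuous_apply_cofactor (φ : ℂ[X] →ₗ[ℂ] ℂ) : Continuous fun z => φ (cofactor k Q n z) := by
  simp only [cofactor, map_sum, map_smul]
  exact continuous_finsetSum _ fun j _ =>
    (continuous_apply_mul_X_sub_C_pow φ _ _).fun_const_smul _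

lemma isEquivalent_apply_cofactor (φ : ℂ[X] →ₗ[ℂ] ℂ) (hφ : φ (Q k) ≠ 0) {s : Set ℂ}
    (hs : IsCompact s) :
    (fun p : ℕ × ℂ => φ (cofactor k Q p.1 p.2)) ~[atTop ×ˢ 𝓟 s] fun _ => φ (Q k) :=
  isLittleO_apply_cofactor_sub (φ := fun _ => φ) (z := id) (f := fun _ => φ (Q k)) fun _ _ =>
    (continuous_apply_mul_X_sub_C_pow φ _ _).continuousOn.isBigO_principal hs
      (norm_ne_zero_iff.2 hφ)

end Cofactor

section Asymptotics

variable {k : ℕ} {Q : ℕ → ℂ[X]} {n : ℕ}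

lemma NonDegenerate.natDegree_add_le (hT : NonDegenerate k Q) {j : ℕ} (hj : j ≤ k)
    (h0 : Q j ≠ 0) : (Q j).natDegree + (k - j) ≤ (Q k).natDegree := by
  have := hT.2 j hj h0
  omega

lemma NonDegenerate.natDegree_mul_X_sub_C_pow_le (hT : NonDegenerate k Q) {j : ℕ} (hj : j ≤ k)
    (z : ℂ) : (Q j * (X - C z) ^ (k - j)).natDegree ≤ (Q k).natDegree := by
  by_cases h0 : Q j = 0
  · simp [h0]
  · refine natDegree_mul_le.trans (le_trans ?_ (hT.natDegree_add_le hj h0))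
    simp

lemma NonDegenerate.natDegree_cofactor_le (hT : NonDegenerate k Q) (z : ℂ) :
    (cofactor k Q n z).natDegree ≤ (Q k).natDegree :=
  natDegree_sum_le_of_forall_le _ _ fun _ hj => (natDegree_smul_le _ _).trans
    (hT.natDegree_mul_X_sub_C_pow_le (Finset.mem_range_succ_iff.1 hj) z)

lemma NonDegenerate.coeff_mul_X_sub_C_pow (hT : NonDegenerate k Q) {j : ℕ} (hj : j ≤ k) (z : ℂ) :
    (Q j * (X - C z) ^ (k - j)).coeff (Q k).natDegree =
      (Q j).coeff ((Q k).natDegree - (k - j)) := by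
  by_cases h0 : Q j = 0
  · simp [h0]
  have h := hT.natDegree_add_le hj h0
  have hdeg : ((X - C z) ^ (k - j)).natDegree = k - j := by simp
  have hmonic : ((X - C z) ^ (k - j)).coeff (k - j) = 1 := by
    simpa [hdeg] using ((monic_X_sub_C z).pow (k - j)).coeff_natDegree
  conv_lhs => rw [← Nat.sub_add_cancel ((Nat.le_add_left _ _).trans h)]
  rw [coeff_mul_add_eq_of_natDegree_le (Nat.le_sub_of_add_le h) hdeg.le, hmonic, mul_one]

lemma NonDegenerate.isEquivalent_coeff_cofactor (hT : NonDegenerate k Q) :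
    (fun p : ℕ × ℂ => (cofactor k Q p.1 p.2).coeff (Q k).natDegree)
      ~[atTop ×ˢ ⊤] fun _ => (Q k).leadingCoeff :=
  isLittleO_apply_cofactor_sub (φ := fun _ => lcoeff ℂ (Q k).natDegree) (z := id)
    (f := fun _ => (Q k).leadingCoeff) fun j hj => by
      simp only [lcoeff_apply, id, hT.coeff_mul_X_sub_C_pow hj.le]
      exact isBigO_const_const _ (leadingCoeff_ne_zero.2 hT.1) _

lemma NonDegenerate.eventually_natDegree_cofactor (hT : NonDegenerate k Q) :
    ∀ᶠ n in atTop, ∀ z, (cofactor k Q n z).natDegree = (Q k).natDegree := by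
  filter_upwards [hT.isEquivalent_coeff_cofactor.isBigO_symm.eq_zero_imp.curry] with n hn z
  refine le_antisymm (hT.natDegree_cofactor_le z) (le_natDegree_of_ne_zero fun h => ?_)
  exact leadingCoeff_ne_zero.2 hT.1 (eventually_top.1 hn z h)

lemma NonDegenerate.isEquivalent_eval_cofactor (hT : NonDegenerate k Q) {B : Set ℂ}
    (hB : Bornology.IsBounded B) {δ : ℝ} (hδ : 0 < δ) :
    (fun p : ℕ × ℂ × ℂ => (cofactor k Q p.1 p.2.1).eval p.2.2)
      ~[atTop ×ˢ 𝓟 (B ×ˢ (thickening δ {r | (Q k).IsRoot r})ᶜ)]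
        fun p => (Q k).eval p.2.2 := by
  refine isLittleO_apply_cofactor_sub (φ := fun y => leval y.2) (z := Prod.fst)
    (f := fun y : ℂ × ℂ => (Q k).eval y.2) fun j hj => ?_
  by_cases h0 : Q j = 0
  · simpa [h0] using isBigO_zero _ _
  have hnum := isBigO_eval_mul_X_sub_C_pow (hT.natDegree_add_le hj.le h0) hB
  have hden := (isBigO_one_add_norm_pow_eval (IsAlgClosed.splits (Q k)) hT.1 hδ).comp_tendsto
    (tendsto_principal_principal.2 fun y (hy : y ∈ B ×ˢ _) => hy.2)
  exact (hnum.mono (principal_mono.2 (Set.prod_mono_right (Set.subset_univ _)))).trans hden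

lemma NonDegenerate.eventually_isRoot_mem_thickening (hT : NonDegenerate k Q) {B : Set ℂ}
    (hB : Bornology.IsBounded B) {δ : ℝ} (hδ : 0 < δ) :
    ∀ᶠ n in atTop, ∀ z ∈ B, ∀ w, (cofactor k Q n z).IsRoot w →
      w ∈ thickening δ {r | (Q k).IsRoot r} := by
  filter_upwards [(hT.isEquivalent_eval_cofactor hB hδ).isBigO_symm.eq_zero_imp.curry]
    with n hn z hz w hw
  by_contra hfar
  exact hfar (self_subset_thickening hδ _ (eventually_principal.1 hn (z, w) ⟨hz, hfar⟩ hw))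

lemma NonDegenerate.eventually_isInvariant_cthickening (hT : NonDegenerate k Q)
    (hroot : ∃ u, (Q k).IsRoot u) {δ : ℝ} (hδ : 0 < δ) :
    ∀ᶠ n in atTop, IsInvariant (diffOp k Q) n (cthickening δ {r | (Q k).IsRoot r}) := by
  have hB := (finite_setOfPred_isRoot hT.1).isBounded.cthickening (δ := δ)
  filter_upwards [hT.eventually_isRoot_mem_thickening hB hδ, eventually_gt_atTop k] with n hn hk
  exact (isInvariant_diffOp_iff hk).2 ⟨isClosed_cthickening,
    hroot.imp fun u hu => self_subset_cthickening _ hu,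
    fun z hz w hw => thickening_subset_cthickening _ _ (hn z hz w hw)⟩

end Asymptotics

section Attraction

variable {k : ℕ} {Q : ℕ → ℂ[X]}

lemma isLittleO_eval_cofactor {u : ℂ} (hu : (Q k).IsRoot u) {l : Filter ℂ} {f : ℂ → ℂ}
    (h : ∀ j < k, Q j ≠ 0 → (fun z => (u - z) ^ (k - j)) =O[l] f) :
    (fun p : ℕ × ℂ => (cofactor k Q p.1 p.2).eval u) =o[atTop ×ˢ l] fun p => f p.2 := by
  have hsub := isLittleO_apply_cofactor_sub (k := k) (Q := Q) (φ := fun _ => leval u) (z := id)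
    (l := l) (f := f) fun j hj => by
      by_cases h0 : Q j = 0
      · simpa [h0] using isBigO_zero _ _
      · simpa using (h j hj h0).const_mul_left ((Q j).eval u)
  simpa only [leval_apply, id, IsRoot.def.1 hu, sub_zero] using hsub

lemma NonDegenerate.eventually_exists_isRoot_dist_lt_of_dist_le_one (hT : NonDegenerate k Q)
    {u : ℂ} (hu : (Q k).IsRoot u) (hu' : (Q k).derivative.eval u ≠ 0) :
    ∀ᶠ n in atTop, ∀ z ≠ u, dist z u ≤ 1 →
      ∃ w, (cofactor k Q n z).IsRoot w ∧ dist u w < dist u z := by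
  have hd : 0 < (Q k).natDegree := natDegree_pos_iff_degree_pos.2 (degree_pos_of_root hT.1 hu)
  have heval := isLittleO_eval_cofactor (l := 𝓟 (closedBall u 1)) (f := (u - ·)) hu
    fun j hj _ => isBigO_principal.2 ⟨1, fun z hz => by
      simpa using pow_le_of_le_one (norm_nonneg (u - z)) (mem_closedBall_iff_norm'.1 hz) (by omega)⟩
  have hderiv : (fun _ : ℕ × ℂ => (1 : ℂ)) =O[atTop ×ˢ 𝓟 (closedBall u 1)]
      fun p => (cofactor k Q p.1 p.2).derivative.eval u :=
    (isBigO_const_const 1 hu' _).trans (isEquivalent_apply_cofactor (leval u ∘ₗ derivative) hu'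
      (isCompact_closedBall u 1)).isBigO_symm
  have hsmall := eventually_norm_lt_norm_of_isLittleO <| (heval.trans_isBigO <| by
    simpa using hderiv.mul (isBigO_refl (fun p => u - p.2) _)).const_mul_left
      ((Q k).natDegree : ℂ)
  filter_upwards [(hsmall.and hderiv.eq_zero_imp).curry, hT.eventually_natDegree_cofactor]
    with n hn hdeg z hzu hz
  obtain ⟨hsmall, hne⟩ := eventually_principal.1 hn z hz
  obtain ⟨w, hw, hle⟩ :=
    exists_isRoot_norm_derivative_mul_le (IsAlgClosed.splits _) (hdeg z ▸ hd) u
  have hlt := hsmall (mul_ne_zero (fun h => one_ne_zero (hne h)) (sub_ne_zero.2 hzu.symm))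
  rw [norm_mul, norm_mul, Complex.norm_natCast, ← hdeg z] at hlt
  simp only [dist_eq_norm]
  exact ⟨w, hw, lt_of_mul_lt_mul_left (hle.trans_lt hlt) (norm_nonneg _)⟩

lemma NonDegenerate.eventually_exists_isRoot_dist_lt_of_one_le_dist (hT : NonDegenerate k Q)
    {u : ℂ} (hu : (Q k).IsRoot u) :
    ∀ᶠ n in atTop, ∀ z, 1 ≤ dist u z →
      ∃ w, (cofactor k Q n z).IsRoot w ∧ dist u w < dist u z := by
  have hd : 0 < (Q k).natDegree := natDegree_pos_iff_degree_pos.2 (degree_pos_of_root hT.1 hu)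
  have heval := isLittleO_eval_cofactor (l := 𝓟 {z | 1 ≤ dist u z})
    (f := fun z => (u - z) ^ (Q k).natDegree) hu fun j hj h0 => by
      refine isBigO_principal.2 ⟨1, fun z hz => ?_⟩
      rw [Set.mem_ofPred_eq, dist_eq_norm] at hz
      simpa using pow_le_pow_right₀ hz (le_of_add_le_right (hT.natDegree_add_le hj.le h0))
  have hcoeff : (fun _ : ℕ × ℂ => (1 : ℂ)) =O[atTop ×ˢ 𝓟 {z | 1 ≤ dist u z}]
      fun p => (cofactor k Q p.1 p.2).coeff (Q k).natDegree :=
    ((isBigO_const_const 1 (leadingCoeff_ne_zero.2 hT.1) _).trans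
      hT.isEquivalent_coeff_cofactor.isBigO_symm).mono (prod_mono_right _ le_top)
  have hsmall := eventually_norm_lt_norm_of_isLittleO <| heval.trans_isBigO <| by
    simpa using hcoeff.mul (isBigO_refl (fun p => (u - p.2) ^ (Q k).natDegree) _)
  filter_upwards [(hsmall.and hcoeff.eq_zero_imp).curry, hT.eventually_natDegree_cofactor]
    with n hn hdeg z hz
  obtain ⟨hsmall, hne⟩ := eventually_principal.1 hn z hz
  obtain ⟨w, hw, hle⟩ := exists_isRoot_norm_sub_pow_le (IsAlgClosed.splits _) (hdeg z ▸ hd) u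
  have hzu : u - z ≠ 0 := sub_ne_zero.2 (dist_pos.1 (zero_lt_one.trans_le hz))
  have hlt := hsmall (mul_ne_zero (fun h => one_ne_zero (hne h)) (pow_ne_zero _ hzu))
  rw [norm_mul, norm_pow] at hlt
  rw [leadingCoeff, hdeg z] at hle
  simp only [dist_eq_norm]
  exact ⟨w, hw, lt_of_pow_lt_pow_left₀ _ (norm_nonneg _) <|
    lt_of_mul_lt_mul_left (hle.trans_lt hlt) (norm_nonneg _)⟩

lemma NonDegenerate.eventually_simpleRoot_mem (hT : NonDegenerate k Q) {u : ℂ}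
    (hu : (Q k).rootMultiplicity u = 1) :
    ∀ᶠ n in atTop, ∀ S, IsInvariant (diffOp k Q) n S → u ∈ S := by
  obtain ⟨hroot, hderiv⟩ := (rootMultiplicity_eq_one_iff hT.1).1 hu
  filter_upwards [hT.eventually_exists_isRoot_dist_lt_of_dist_le_one hroot hderiv,
    hT.eventually_exists_isRoot_dist_lt_of_one_le_dist hroot, eventually_gt_atTop k]
    with n hnear hfar hk S hS
  obtain ⟨hclosed, hne, hinv⟩ := (isInvariant_diffOp_iff hk).1 hS
  refine mem_of_forall_exists_dist_lt hclosed hne fun z hz hzu => ?_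
  obtain ⟨w, hw, hlt⟩ := (le_total (dist z u) 1).elim (hnear z hzu)
    fun h => hfar z (dist_comm z u ▸ h)
  exact ⟨w, hinv z hz w hw, hlt⟩

end Attraction

section Minimal

variable {T : ℂ[X] →ₗ[ℂ] ℂ[X]} {n : ℕ}

lemma isMinimalInvariant_sInter {u : ℂ} (hu : ∀ S, IsInvariant T n S → u ∈ S) :
    IsMinimalInvariant T n (⋂₀ {S | IsInvariant T n S}) :=
  ⟨⟨isClosed_sInter fun _ hS => hS.1, ⟨u, Set.mem_sInter.2 hu⟩, fun z hz w hw =>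
    Set.mem_sInter.2 fun S hS => hS.2.2 z (Set.mem_sInter.1 hz S hS) w hw⟩,
    fun _ hS => Set.sInter_subset_of_mem hS⟩

lemma IsMinimalInvariant.accPt {M : Set ℂ} (hM : IsMinimalInvariant T n M) {u : ℂ} (hu : u ∈ M)
    (hother : ∃ w ≠ u, (T ((X - C u) ^ n)).IsRoot w)
    (hback : ∀ z ∈ M, z ≠ u → ¬(T ((X - C z) ^ n)).IsRoot u) : AccPt u (𝓟 M) := by
  obtain ⟨⟨hclosed, -, hinv⟩, hmin⟩ := hM
  rw [accPt_principal_iff_clusterPt, ← mem_closure_iff_clusterPt]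
  by_contra hu'
  have hclosed' : IsClosed (M \ {u}) := isClosed_of_closure_subset fun z hz =>
    ⟨hclosed.closure_subset_iff.2 Set.sdiff_subset hz, by rintro rfl; exact hu' hz⟩
  obtain ⟨w, hwu, hw⟩ := hother
  have hdiff : IsInvariant T n (M \ {u}) := ⟨hclosed', ⟨w, hinv u hu w hw, hwu⟩,
    fun z hz v hv => ⟨hinv z hz.1 v hv, by rintro rfl; exact hback z hz.1 hz.2 hv⟩⟩
  exact (hmin hdiff hu).2 rfl

end Minimal

section Perfectness

variable {k : ℕ} {Q : ℕ → ℂ[X]} {n : ℕ}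

lemma eval_cofactor_of_vanishing {m : ℕ} (hm : m ≤ k) (hk : k ≤ n) {u : ℂ}
    (h : ∀ j, m < j → j ≤ k → (Q j).eval u = 0) (z : ℂ) :
    (cofactor k Q n z).eval u =
      weight k n m * (u - z) ^ (k - m) * (cofactor m Q n z).eval u := by
  rw [eval_cofactor, eval_cofactor, Finset.mul_sum]
  refine (Finset.sum_subset_zero_on_sdiff (Finset.range_subset_range.2 (Nat.succ_le_succ hm))
    (fun j hj => ?_) fun j hj => ?_).symm
  · simp only [Finset.mem_sdiff, Finset.mem_range] at hj
    rw [h j (by omega) (by omega), zero_mul, mul_zero]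
  · have hjm : j ≤ m := Finset.mem_range_succ_iff.1 hj
    rw [← weight_mul_weight (k := k) (hm.trans hk) j, show k - j = (k - m) + (m - j) by omega,
      pow_add]
    ring

lemma eventually_not_isRoot_cofactor {u : ℂ} (hu : ∃ j ≤ k, ¬(Q j).IsRoot u) {s : Set ℂ}
    (hs : IsCompact s) :
    ∀ᶠ n in atTop, ∀ z ∈ s, z ≠ u → ¬(cofactor k Q n z).IsRoot u := by
  classical
  obtain ⟨j₀, hj₀, hne⟩ := hu
  set m := Nat.findGreatest (fun j => ¬(Q j).IsRoot u) k
  have hm : m ≤ k := Nat.findGreatest_le k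
  have hQm : (Q m).eval u ≠ 0 := Nat.findGreatest_spec (P := fun j => ¬(Q j).IsRoot u) hj₀ hne
  have hvanish : ∀ j, m < j → j ≤ k → (Q j).eval u = 0 := fun j hmj hjk =>
    not_not.1 (Nat.findGreatest_is_greatest hmj hjk)
  have hequiv := isEquivalent_apply_cofactor (leval u) hQm hs
  filter_upwards [hequiv.isBigO_symm.eq_zero_imp.curry, eventually_ge_atTop k] with n hn hk z hz hzu
  rw [IsRoot.def, eval_cofactor_of_vanishing hm hk hvanish]
  exact mul_ne_zero (mul_ne_zero (weight_ne_zero hk (hm.trans hk))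
    (pow_ne_zero _ (sub_ne_zero.2 hzu.symm))) fun h => hQm (eventually_principal.1 hn z hz h)

lemma exists_ne_zero_eval_cofactor_eq (hk : k ≤ n) {x : ℂ} (hx : ∃ j ≤ k, ¬(Q j).IsRoot x) :
    ∃ R : ℂ[X], R ≠ 0 ∧ ∀ z, (cofactor k Q n z).eval x = R.eval (x - z) := by
  obtain ⟨j, hj, hne⟩ := hx
  refine ⟨∑ i ∈ Finset.range (k + 1), C (weight k n i * (Q i).eval x) * X ^ (k - i),
    fun h0 => ?_, fun z => by simp [eval_cofactor, eval_finsetSum, mul_assoc]⟩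
  have hcoeff := congrArg (coeff · (k - j)) h0
  rw [finsetSum_coeff, Finset.sum_eq_single_of_mem j (Finset.mem_range_succ_iff.2 hj)
    fun i hi hij => ?_, coeff_C_mul_X_pow, if_pos rfl, coeff_zero] at hcoeff
  · exact mul_ne_zero (weight_ne_zero hk (hj.trans hk)) hne hcoeff
  · have := Finset.mem_range_succ_iff.1 hi
    rw [coeff_C_mul_X_pow, if_neg (by omega)]

lemma finite_setOf_isRoot_cofactor (hk : k ≤ n) {x : ℂ} (hx : ∃ j ≤ k, ¬(Q j).IsRoot x) :
    {z | (cofactor k Q n z).IsRoot x}.Finite := by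
  obtain ⟨R, hR0, hR⟩ := exists_ne_zero_eval_cofactor_eq hk hx
  simp only [IsRoot.def, hR]
  exact (finite_setOfPred_isRoot hR0).preimage sub_right_injective.injOn

lemma eventually_exists_isRoot_cofactor_dist_lt {d : ℕ} (hd : 0 < d)
    (hdeg : ∀ z, (cofactor k Q n z).natDegree = d) {z x : ℂ} (hx : (cofactor k Q n z).IsRoot x)
    {δ : ℝ} (hδ : 0 < δ) :
    ∀ᶠ z' in 𝓝 z, ∃ r, (cofactor k Q n z').IsRoot r ∧ ‖x - r‖ < δ :=
  eventually_exists_isRoot_norm_sub_lt (.of_forall fun _ => IsAlgClosed.splits _) hd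
    (.of_forall hdeg) (continuous_apply_cofactor (lcoeff ℂ d)).continuousAt
    (continuous_apply_cofactor (leval x)).continuousAt hx hδ

-- A root of the cofactor at an accumulation point `z` is approached by roots at points `z' → z`,
-- and it is itself a root for only finitely many `z'`.
lemma IsInvariant.derivedSet {S : Set ℂ} (hS : IsInvariant (diffOp k Q) n S) (hk : k < n) {d : ℕ}
    (hd : 0 < d) (hdeg : ∀ z, (cofactor k Q n z).natDegree = d)
    (hcommon : ∀ w, ∃ j ≤ k, ¬(Q j).IsRoot w) (hne : (derivedSet S).Nonempty) :
    IsInvariant (diffOp k Q) n (derivedSet S) := by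
  obtain ⟨-, -, hinv⟩ := (isInvariant_diffOp_iff hk).1 hS
  refine (isInvariant_diffOp_iff hk).2 ⟨isClosed_derivedSet S, hne, fun z hz w hw => ?_⟩
  rw [mem_derivedSet, accPt_iff_nhds]
  intro U hU
  obtain ⟨δ, hδ, hball⟩ := Metric.mem_nhds_iff.1 hU
  have hroot := eventually_exists_isRoot_cofactor_dist_lt hd hdeg hw hδ
  have hfew := nhdsNE_le_cofinite z
    (finite_setOf_isRoot_cofactor hk.le (hcommon w)).eventually_cofinite_notMem
  obtain ⟨z', hz'S, ⟨r, hr, hlt⟩, hz'⟩ := ((accPt_iff_frequently_nhdsNE.1 hz).and_eventually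
    ((hroot.filter_mono nhdsWithin_le_nhds).and hfew)).exists
  refine ⟨r, ⟨hball ?_, hinv z' hz'S r hr⟩, ?_⟩
  · rwa [mem_ball_iff_norm']
  · rintro rfl
    exact hz' hr

lemma IsMinimalInvariant.perfect {M : Set ℂ} (hM : IsMinimalInvariant (diffOp k Q) n M)
    (hk : k < n) {d : ℕ} (hd : 0 < d) (hdeg : ∀ z, (cofactor k Q n z).natDegree = d)
    (hcommon : ∀ w, ∃ j ≤ k, ¬(Q j).IsRoot w) (hne : (derivedSet M).Nonempty) : Perfect M :=
  perfect_iff_eq_derivedSet.2 <| (hM.2 (hM.1.derivedSet hk hd hdeg hcommon hne)).antisymm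
    ((isClosed_iff_derivedSet_subset M).1 hM.1.1)

lemma NonDegenerate.eventually_exists_isRoot_cofactor_ne (hT : NonDegenerate k Q) {u : ℂ}
    (hu : (Q k).rootMultiplicity u = 1) (hd : 2 ≤ (Q k).natDegree) :
    ∀ᶠ n in atTop, ∃ w ≠ u, (cofactor k Q n u).IsRoot w := by
  obtain ⟨hroot, hderiv⟩ := (rootMultiplicity_eq_one_iff hT.1).1 hu
  have hequiv := isEquivalent_apply_cofactor (leval u ∘ₗ derivative) hderiv
    (isCompact_singleton (x := u))
  filter_upwards [hequiv.isBigO_symm.eq_zero_imp.curry, hT.eventually_natDegree_cofactor,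
    eventually_ge_atTop k] with n hn hdeg hk
  have hne0 : cofactor k Q n u ≠ 0 := ne_zero_of_natDegree_gt (hdeg u ▸ hd)
  have hone : (cofactor k Q n u).rootMultiplicity u = 1 :=
    (rootMultiplicity_eq_one_iff hne0).2 ⟨(eval_cofactor_self hk u).trans hroot,
      fun h => hderiv (eventually_principal.1 hn u rfl h)⟩
  obtain ⟨w, hw, hwu⟩ := exists_isRoot_ne (IsAlgClosed.splits _) (by rw [hone, hdeg u]; exact hd)
  exact ⟨w, hwu, hw⟩

lemma NonDegenerate.eventually_perfect (hT : NonDegenerate k Q) {u : ℂ}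
    (hu : (Q k).rootMultiplicity u = 1) (hd : 2 ≤ (Q k).natDegree)
    (hcommon : ∀ w, ∃ j ≤ k, ¬(Q j).IsRoot w) :
    ∀ᶠ n in atTop, ∀ M, IsMinimalInvariant (diffOp k Q) n M → Perfect M := by
  have hK : IsCompact (cthickening 1 {r | (Q k).IsRoot r}) :=
    (finite_setOfPred_isRoot hT.1).isCompact.cthickening
  have hroot := ((rootMultiplicity_eq_one_iff hT.1).1 hu).1
  filter_upwards [hT.eventually_isInvariant_cthickening ⟨u, hroot⟩ one_pos,
    hT.eventually_simpleRoot_mem hu, hT.eventually_natDegree_cofactor,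
    hT.eventually_exists_isRoot_cofactor_ne hu hd, eventually_not_isRoot_cofactor (hcommon u) hK,
    eventually_gt_atTop k] with n hthick hmem hdeg hother hback hk M hM
  have huM : u ∈ M := hmem M hM.1
  obtain ⟨w, hwu, hw⟩ := hother
  refine hM.perfect hk (by omega) hdeg hcommon
    ⟨u, hM.accPt huM ⟨w, hwu, (isRoot_diffOp_iff hk u w).2 (.inr hw)⟩ fun z hz hzu h => ?_⟩
  exact ((isRoot_diffOp_iff hk z u).1 h).elim hzu.symm (hback z (hM.2 hthick hz) hzu)

end Perfectness

end Hutchinson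

open Hutchinson Polynomial Filter in
theorem mainTheorem4_general (k : ℕ) (Q : ℕ → ℂ[X]) (hT : NonDegenerate k Q)
    (hsimple : ∃ u₀, (Q k).rootMultiplicity u₀ = 1) {ε : ℝ} (hε : 0 < ε) :
    ∀ᶠ n in atTop, ∃ S : Set ℂ, IsMinimalInvariant (diffOp k Q) n S ∧
      S ⊆ Metric.thickening ε {w | (Q k).IsRoot w} ∧
      {u | (Q k).rootMultiplicity u = 1} ⊆ S ∧
      (2 ≤ (Q k).natDegree → (∀ w, ∃ j ≤ k, ¬(Q j).IsRoot w) → Perfect S) := by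
  obtain ⟨u, hu⟩ := hsimple
  have hroot {w : ℂ} (hw : (Q k).rootMultiplicity w = 1) : (Q k).IsRoot w :=
    ((rootMultiplicity_eq_one_iff hT.1).1 hw).1
  have hfin : {w | (Q k).rootMultiplicity w = 1}.Finite :=
    (finite_setOfPred_isRoot hT.1).subset fun _ => hroot
  have hperfect : ∀ᶠ n in atTop, 2 ≤ (Q k).natDegree → (∀ w, ∃ j ≤ k, ¬(Q j).IsRoot w) →
      ∀ M, IsMinimalInvariant (diffOp k Q) n M → Perfect M :=
    eventually_imp_distrib_left.2 fun hd => eventually_imp_distrib_left.2 fun hcommon =>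
      hT.eventually_perfect hu hd hcommon
  filter_upwards [hT.eventually_isInvariant_cthickening ⟨u, hroot hu⟩ (half_pos hε),
    (eventually_all_finite hfin).2 fun w hw => hT.eventually_simpleRoot_mem hw, hperfect]
    with n hthick hmem hperfect
  have hmin := isMinimalInvariant_sInter (hmem u hu)
  exact ⟨_, hmin,
    (hmin.2 hthick).trans (Metric.cthickening_subset_thickening' hε (half_lt_self hε) _),
    fun w hw => Set.mem_sInter.2 (hmem w hw), fun hd hcommon => hperfect hd hcommon _ hmin⟩

theorem mainTheorem4 (k : ℕ) (hk : 1 ≤ k) (Q : ℕ → Polynomial ℂ)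
    (hT : Hutchinson.NonDegenerate k Q)
    (hsimple : ∃ u₀ : ℂ, (Q k).rootMultiplicity u₀ = 1) :
    ∀ ε : ℝ, 0 < ε → ∃ N : ℕ, ∀ n : ℕ, N ≤ n →
      ∃ S : Set ℂ, Hutchinson.IsMinimalInvariant (Hutchinson.diffOp k Q) n S ∧
        S ⊆ Metric.thickening ε {w : ℂ | (Q k).IsRoot w} ∧
        {u : ℂ | (Q k).rootMultiplicity u = 1} ⊆ S ∧
        (2 ≤ k → (∃ j < k, Q j ≠ 0) →
          2 ≤ (Q k).natDegree → (∀ w : ℂ, ∃ j ≤ k, ¬ (Q j).IsRoot w) →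
          Perfect S) := by
  intro ε hε
  obtain ⟨N, hN⟩ := Filter.eventually_atTop.1 (mainTheorem4_general k Q hT hsimple hε)
  exact ⟨N, fun n hn => (hN n hn).imp fun S hS => ⟨hS.1, hS.2.1, hS.2.2.1, fun _ _ => hS.2.2.2⟩⟩
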